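/- Let $M$ (memory) and $S$ (system) be quantum systems with finite-dimensional Hilbert spaces $\mathcal H_M,\mathcal H_S$, and let $\rho_{MS}$ be a state on $\mathcal H_M\otimes\mathcal H_S$ that is separable: $\rho_{MS}=\sum_k\lambda_k\,\rho_M^k\otimes\rho_S^k$ (a finite sum) with $\lambda_k>0$, $\sum_k\lambda_k=1$, and $\rho_M^k,\rho_S^k$ positive semidefinite of trace $1$. Put $\rho_M=\mathrm{Tr}_S\,\rho_{MS}$ and fix an inverse temperature $\beta>0$. A thermal process consists of a reservoir $R$ with a nonzero finite-dimensional Hilbert space and Hamiltonian $H_R=H_R^\dagger$, and a unitary $U$ on $\mathcal H_M\otimes\mathcal H_S\otimes\mathcal H_R$. The global system starts in $\rho_{MS}\otimes\rho_R^{\rm eq}$, where $\rho_R^{\rm eq}=e^{-\beta H_R}/\mathrm{Tr}\,e^{-\beta H_R}$, and ends in $\rho'_{MSR}=U(\rho_{MS}\otimes\rho_R^{\rm eq})U^\dagger$, with reduced states $\rho'_{MS}=\mathrm{Tr}_R\,\rho'_{MSR}$ and $\rho'_R=\mathrm{Tr}_{MS}\,\rho'_{MSR}$. The heat dissipation is the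 energy change of the reservoir, $-Q=\mathrm{Tr}\{H_R[\rho'_R-\rho_R^{\rm eq}]\}$. 1. If the process is a memory-assisted purification, that is, $\rho'_{MS}=\rho_M\otimes|\Psi\rangle\langle\Psi|$ for some unit vector $\Psi\in\mathcal H_S$, then $-Q\ge 0$. 2. The same holds for memory-assisted purification attained in a limit: if for a sequence of thermal processes at the same $\beta$ (the reservoir, $H_R$ and $U$ may change along the sequence) the final states converge, $\rho'^{(n)}_{MS}\to\rho_M\otimes|\Psi\rangle\langle\Psi|$ for some unit vector $\Psi\in\mathcal H_S$, then $\liminf_{n\to\infty}(-Q_n)\ge 0$. -/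

import Mathlib

open scoped Kronecker Matrix ComplexOrder

namespace MemoryPurification

noncomputable section

/-- A density matrix: positive semidefinite with trace one. -/
def IsDensity {a : Type*} [Fintype a] (ρ : Matrix a a ℂ) : Prop :=
  ρ.PosSemidef ∧ ρ.trace = 1

/-- A bipartite state is separable if it is a finite convex combination, with positive
probabilities, of tensor products of density matrices. -/
def IsSeparable {a b : Type*} [Fintype a] [Fintype b]
    (ρ : Matrix (a × b) (a × b) ℂ) : Prop :=
  ∃ (n : ℕ) (w : Fin n → ℝ) (A : Fin n → Matrix a a ℂ) (B : Fin n → Matrix b b ℂ),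
    (∀ k, 0 < w k) ∧ ∑ k, w k = 1 ∧ (∀ k, IsDensity (A k)) ∧ (∀ k, IsDensity (B k)) ∧
      ρ = ∑ k, (w k : ℂ) • (A k ⊗ₖ B k)

/-- The reduced matrix of the first factor (partial trace over the second). -/
def reducedFst {a b : Type*} [Fintype b] (ρ : Matrix (a × b) (a × b) ℂ) : Matrix a a ℂ :=
  Matrix.of fun i j => ∑ k, ρ (i, k) (j, k)

/-- The reduced matrix of the second factor (partial trace over the first). -/
def reducedSnd {a b : Type*} [Fintype a] (ρ : Matrix (a × b) (a × b) ℂ) : Matrix b b ℂ :=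
  Matrix.of fun i j => ∑ k, ρ (k, i) (k, j)

/-- The matrix `|Ψ⟩⟨Ψ|`. -/
def ketBra {a : Type*} (Ψ : EuclideanSpace ℂ a) : Matrix a a ℂ :=
  Matrix.of fun i j => Ψ i * star (Ψ j)

/-- The Gibbs state `exp(-β H) / Tr exp(-β H)`. -/
def gibbs {r : Type*} [Fintype r] [DecidableEq r] (β : ℝ) (H : Matrix r r ℂ) : Matrix r r ℂ :=
  (NormedSpace.exp (-(β : ℂ) • H)).trace⁻¹ • NormedSpace.exp (-(β : ℂ) • H)

/-- A global evolution of memory (basis `m`), system (basis `s`) and a reservoir: the reservoir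
Hilbert space `ℂ^dim` with its Hamiltonian, and the unitary propagator `U` of the closed
composite system from the initial to the final time. -/
structure ThermalProcess (m s : Type*) [Fintype m] [Fintype s] [DecidableEq m]
    [DecidableEq s] where
  /-- the dimension of the reservoir Hilbert space -/
  dim : ℕ
  dim_pos : 0 < dim
  /-- the reservoir Hamiltonian -/
  HR : Matrix (Fin dim) (Fin dim) ℂ
  isHermitian_HR : HR.IsHermitian
  /-- the unitary propagator of memory, system and reservoir -/
  U : Matrix ((m × s) × Fin dim) ((m × s) × Fin dim) ℂ
  unitary_U : U ∈ Matrix.unitaryGroup ((m × s) × Fin dim) ℂ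

namespace ThermalProcess

variable {m s : Type*} [Fintype m] [Fintype s] [DecidableEq m] [DecidableEq s]

/-- The final global state `U (ρ_MS ⊗ ρ_R^eq) U†`, with the reservoir initially in the Gibbs
state at inverse temperature `β`. -/
def finalState (P : ThermalProcess m s) (β : ℝ) (ρ : Matrix (m × s) (m × s) ℂ) :
    Matrix ((m × s) × Fin P.dim) ((m × s) × Fin P.dim) ℂ :=
  P.U * (ρ ⊗ₖ gibbs β P.HR) * P.Uᴴ

/-- The final state of memory and system. -/
def finalMS (P : ThermalProcess m s) (β : ℝ) (ρ : Matrix (m × s) (m × s) ℂ) :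
    Matrix (m × s) (m × s) ℂ :=
  reducedFst (P.finalState β ρ)

/-- The final state of the reservoir. -/
def finalR (P : ThermalProcess m s) (β : ℝ) (ρ : Matrix (m × s) (m × s) ℂ) :
    Matrix (Fin P.dim) (Fin P.dim) ℂ :=
  reducedSnd (P.finalState β ρ)

/-- The heat `Q`, defined by `-Q = Tr {H_R [ρ_R(t) - ρ_R^eq]}`. The trace is a real number
when `ρ` is Hermitian, and `re` only turns it into an element of `ℝ`. -/
def heat (P : ThermalProcess m s) (β : ℝ) (ρ : Matrix (m × s) (m × s) ℂ) : ℝ :=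
  -(P.HR * (P.finalR β ρ - gibbs β P.HR)).trace.re

end ThermalProcess

/-- `ρ → ρ_M ⊗ |Ψ⟩⟨Ψ|`: the final state `ρ'` of memory and system is the unchanged reduced state
of the memory tensored with some pure state of the system. -/
def IsMemoryAssistedPurification {m s : Type*} [Fintype s]
    (ρ ρ' : Matrix (m × s) (m × s) ℂ) : Prop :=
  ∃ Ψ : EuclideanSpace ℂ s, ‖Ψ‖ = 1 ∧ ρ' = reducedFst ρ ⊗ₖ ketBra Ψ

/-- Memory-assisted purification attained in a limit (quasistatic processes, diverging energy
gaps, growing reservoirs): the final states `ρ' n` converge to `ρ_M ⊗ |Ψ⟩⟨Ψ|`. -/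
def IsLimitMemoryAssistedPurification {m s : Type*} [Fintype s]
    (ρ : Matrix (m × s) (m × s) ℂ) (ρ' : ℕ → Matrix (m × s) (m × s) ℂ) : Prop :=
  ∃ Ψ : EuclideanSpace ℂ s, ‖Ψ‖ = 1 ∧
    Filter.Tendsto ρ' Filter.atTop (nhds (reducedFst ρ ⊗ₖ ketBra Ψ))

end

end MemoryPurification

/-!
Comparing the final global state with `σ ⊗ ρ_R^eq`, for an arbitrary positive definite `σ` on memory
and system, Klein's inequality and the unitary invariance of the entropy give
`β (-Q) ≥ S(ρ_MS) + Tr ρ'_MS log σ + 1 - Tr σ` (`ThermalProcess.le_mul_neg_heat`). This combines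
subadditivity with the minimality of the free energy of the Gibbs state, and its right-hand side is
linear in the final state `ρ'_MS`, so that limits need no continuity of the entropy.

With `σ = (ρ_M + δ) ⊗ (|Ψ⟩⟨Ψ| + δ)` and `ρ'_MS = ρ_M ⊗ |Ψ⟩⟨Ψ|` the right-hand side is at least
`S(ρ_MS) + Tr ρ_M log (ρ_M + δ) + 1 - Tr σ`, where `Tr σ → 1` as `δ → 0`. A separable state satisfies
the reduction criterion `ρ_MS ≤ ρ_M ⊗ 1` (`IsSeparable.posSemidef_reducedFst_kronecker_one_sub`),
hence `Tr ρ_MS log ρ_MS ≤ Tr ρ_MS log ((ρ_M + δ) ⊗ 1) = Tr ρ_M log (ρ_M + δ)`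
(`sum_mul_log_le_of_le`). In the limit `δ → 0` this says `S(ρ_M) ≤ S(ρ_MS)`.
-/

namespace MemoryPurification

open Matrix

/-! ### Hermitian matrices in spectral form -/

section SpectralForm

variable {a b : Type*} [Fintype a] [DecidableEq a] [Fintype b] [DecidableEq b]

/-- The matrix `V diag(f) V†`. For unitary `V` it is the Hermitian matrix with eigenvalues `f i` and
eigenvectors the columns of `V`, and applying a real function to that matrix amounts to applying
it to `f`: logarithms are written `conjDiag V (Real.log ∘ f)`. -/
noncomputable def conjDiag (V : Matrix a a ℂ) (f : a → ℝ) : Matrix a a ℂ :=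
  V * diagonal (fun i => (f i : ℂ)) * Vᴴ


theorem exists_eq_conjDiag {A : Matrix a a ℂ} (hA : A.IsHermitian) :
    ∃ V ∈ unitaryGroup a ℂ, A = conjDiag V hA.eigenvalues := by
  refine ⟨hA.eigenvectorUnitary, hA.eigenvectorUnitary.2, ?_⟩
  conv_lhs => rw [hA.spectral_theorem]
  rfl

theorem conjTranspose_mul_self_of_mem {V : Matrix a a ℂ} (hV : V ∈ unitaryGroup a ℂ) :
    Vᴴ * V = 1 := mem_unitaryGroup_iff'.1 hV

theorem mul_conjTranspose_self_of_mem {V : Matrix a a ℂ} (hV : V ∈ unitaryGroup a ℂ) :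
    V * Vᴴ = 1 := mem_unitaryGroup_iff.1 hV

theorem conjTranspose_mul_mem {U V : Matrix a a ℂ} (hU : U ∈ unitaryGroup a ℂ)
    (hV : V ∈ unitaryGroup a ℂ) : Uᴴ * V ∈ unitaryGroup a ℂ :=
  mul_mem (Unitary.star_mem hU) hV

theorem conjDiag_add (V : Matrix a a ℂ) (f g : a → ℝ) :
    conjDiag V (fun i => f i + g i) = conjDiag V f + conjDiag V g := by
  simp [conjDiag, ← diagonal_add, mul_add, add_mul]

theorem conjDiag_smul (V : Matrix a a ℂ) (c : ℝ) (f : a → ℝ) :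
    conjDiag V (fun i => c * f i) = (c : ℂ) • conjDiag V f := by
  have : diagonal (fun i => ((c * f i : ℝ) : ℂ)) = (c : ℂ) • diagonal (fun i => (f i : ℂ)) := by
    rw [← diagonal_smul]; congr 1; ext i; simp
  simp only [conjDiag, this, Matrix.mul_smul, Matrix.smul_mul]

theorem conjDiag_const {V : Matrix a a ℂ} (hV : V ∈ unitaryGroup a ℂ) (c : ℝ) :
    conjDiag V (fun _ => c) = (c : ℂ) • (1 : Matrix a a ℂ) := by
  have : diagonal (fun _ : a => (c : ℂ)) = (c : ℂ) • (1 : Matrix a a ℂ) := by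
    rw [smul_one_eq_diagonal]
  simp only [conjDiag, this, Matrix.mul_smul, Matrix.smul_mul, mul_one,
    mul_conjTranspose_self_of_mem hV]

theorem conjDiag_kronecker (V : Matrix a a ℂ) (W : Matrix b b ℂ) (f : a → ℝ) (g : b → ℝ) :
    conjDiag V f ⊗ₖ conjDiag W g = conjDiag (V ⊗ₖ W) (fun x => f x.1 * g x.2) := by
  simp only [conjDiag, mul_kronecker_mul, diagonal_kronecker_diagonal, conjTranspose_kronecker,
    Complex.ofReal_mul]

theorem conjDiag_log_kronecker {V : Matrix a a ℂ} {W : Matrix b b ℂ} (hV : V ∈ unitaryGroup a ℂ)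
    (hW : W ∈ unitaryGroup b ℂ) {f : a → ℝ} {g : b → ℝ} (hf : ∀ i, 0 < f i) (hg : ∀ i, 0 < g i) :
    conjDiag (V ⊗ₖ W) (fun x => Real.log (f x.1 * g x.2)) =
      conjDiag V (fun i => Real.log (f i)) ⊗ₖ (1 : Matrix b b ℂ) +
        (1 : Matrix a a ℂ) ⊗ₖ conjDiag W (fun i => Real.log (g i)) := by
  have e1 := conjDiag_const hV 1
  have e2 := conjDiag_const hW 1
  rw [Complex.ofReal_one, one_smul] at e1 e2
  rw [← e1, ← e2, conjDiag_kronecker, conjDiag_kronecker, ← conjDiag_add]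
  congr 1
  ext x
  rw [Real.log_mul (hf _).ne' (hg _).ne', mul_one, one_mul]

theorem conjDiag_conj (U V : Matrix a a ℂ) (f : a → ℝ) :
    U * conjDiag V f * Uᴴ = conjDiag (U * V) f := by
  simp only [conjDiag, conjTranspose_mul, Matrix.mul_assoc]

theorem conjDiag_mul {V : Matrix a a ℂ} (hV : V ∈ unitaryGroup a ℂ) (f g : a → ℝ) :
    conjDiag V f * conjDiag V g = conjDiag V (fun i => f i * g i) := by
  have : conjDiag V f * conjDiag V g = V * (diagonal (fun i => (f i : ℂ)) * (Vᴴ * V) *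
      diagonal (fun i => (g i : ℂ))) * Vᴴ := by
    simp only [conjDiag, Matrix.mul_assoc]
  rw [this, conjTranspose_mul_self_of_mem hV, mul_one, diagonal_mul_diagonal]
  simp [conjDiag]

theorem conjDiag_injective {V : Matrix a a ℂ} (hV : V ∈ unitaryGroup a ℂ) :
    Function.Injective (conjDiag V) := by
  intro f g h
  have key : ∀ f : a → ℝ, Vᴴ * conjDiag V f * V = diagonal (fun i => (f i : ℂ)) := by
    intro f
    have : Vᴴ * conjDiag V f * V = (Vᴴ * V) * diagonal (fun i => (f i : ℂ)) * (Vᴴ * V) := by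
      simp only [conjDiag, Matrix.mul_assoc]
    rw [this, conjTranspose_mul_self_of_mem hV, mul_one, one_mul]
  have h2 := (key f).symm.trans ((by rw [h] : _ = Vᴴ * conjDiag V g * V).trans (key g))
  ext i
  exact_mod_cast congrFun (diagonal_injective h2) i

theorem trace_conjDiag {V : Matrix a a ℂ} (hV : V ∈ unitaryGroup a ℂ) (f : a → ℝ) :
    (conjDiag V f).trace = ((∑ i, f i : ℝ) : ℂ) := by
  rw [conjDiag, trace_mul_comm, ← Matrix.mul_assoc, conjTranspose_mul_self_of_mem hV, one_mul,
    trace_diagonal, Complex.ofReal_sum]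

theorem sum_eq_one_of_trace {V A : Matrix a a ℂ} (hV : V ∈ unitaryGroup a ℂ) {f : a → ℝ}
    (hA : A = conjDiag V f) (htr : A.trace = 1) : ∑ i, f i = 1 := by
  rw [hA, trace_conjDiag hV] at htr
  exact_mod_cast htr

theorem posSemidef_conjDiag (V : Matrix a a ℂ) {f : a → ℝ} (hf : ∀ i, 0 ≤ f i) :
    (conjDiag V f).PosSemidef :=
  (PosSemidef.diagonal fun i => by simpa using hf i).mul_mul_conjTranspose_same V

/-- The trace pairing of two Hermitian matrices in terms of their eigenvalues and the squared
overlaps of their eigenvectors. -/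
theorem re_trace_conjDiag_mul_conjDiag (U V : Matrix a a ℂ) (p f : a → ℝ) :
    (conjDiag U p * conjDiag V f).trace.re =
      ∑ i, ∑ j, ‖(Uᴴ * V) i j‖ ^ 2 * (p i * f j) := by
  set C := Uᴴ * V with hC
  have h1 : (conjDiag U p * conjDiag V f).trace =
      (diagonal (fun i => (p i : ℂ)) * (C * diagonal (fun i => (f i : ℂ)) * Cᴴ)).trace := by
    have : conjDiag U p * conjDiag V f = U * (diagonal (fun i => (p i : ℂ)) * Uᴴ * V *
        diagonal (fun i => (f i : ℂ)) * Vᴴ) := by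
      simp only [conjDiag, Matrix.mul_assoc]
    rw [this, trace_mul_comm, hC, conjTranspose_mul, conjTranspose_conjTranspose]
    simp only [Matrix.mul_assoc]
  rw [h1, trace, Complex.re_sum]
  refine Finset.sum_congr rfl fun i _ => ?_
  rw [diag_apply, diagonal_mul, mul_apply, Complex.re_ofReal_mul, Complex.re_sum, Finset.mul_sum]
  refine Finset.sum_congr rfl fun j _ => ?_
  rw [mul_diagonal, conjTranspose_apply, mul_right_comm, Complex.star_def, Complex.mul_conj,
    Complex.normSq_eq_norm_sq, ← Complex.ofReal_mul, Complex.ofReal_re]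
  ring

theorem sum_row_sq_norm {C : Matrix a a ℂ} (hC : C ∈ unitaryGroup a ℂ) (i : a) :
    ∑ j, ‖C i j‖ ^ 2 = 1 := by
  have h := congrFun (congrFun (mul_conjTranspose_self_of_mem hC) i) i
  simp only [mul_apply, conjTranspose_apply, Complex.star_def, Complex.mul_conj,
    Complex.normSq_eq_norm_sq, one_apply_eq] at h
  exact_mod_cast h

theorem sum_col_sq_norm {C : Matrix a a ℂ} (hC : C ∈ unitaryGroup a ℂ) (j : a) :
    ∑ i, ‖C i j‖ ^ 2 = 1 := by
  have h := sum_row_sq_norm (C := Cᴴ) (Unitary.star_mem hC) j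
  simpa [conjTranspose_apply] using h

end SpectralForm

/-! ### Klein's inequality and monotonicity of the logarithm -/

section Entropy

variable {a : Type*} [Fintype a] [DecidableEq a]

theorem mul_log_add_sub_le {x y : ℝ} (hx : 0 ≤ x) (hy : 0 < y) :
    x * Real.log y + x - y ≤ x * Real.log x := by
  rcases hx.eq_or_lt with rfl | hx
  · simpa using hy.le
  · have h := Real.log_le_sub_one_of_pos (div_pos hy hx)
    rw [Real.log_div hy.ne' hx.ne'] at h
    have h2 := mul_le_mul_of_nonneg_left h hx.le
    have h3 : x * (y / x - 1) = y - x := by field_simp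
    nlinarith

/-- **Klein's inequality**: `Tr ρ log σ + Tr ρ - Tr σ ≤ Tr ρ log ρ` for `ρ ≥ 0` with eigenvalues `p`
and `σ > 0` with eigenvalues `q`. -/
theorem klein_inequality {U V : Matrix a a ℂ} (hU : U ∈ unitaryGroup a ℂ)
    (hV : V ∈ unitaryGroup a ℂ) {p q : a → ℝ} (hp : ∀ i, 0 ≤ p i) (hq : ∀ i, 0 < q i) :
    (conjDiag U p * conjDiag V (fun i => Real.log (q i))).trace.re + ∑ i, p i - ∑ i, q i ≤
      ∑ i, p i * Real.log (p i) := by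
  have hC := conjTranspose_mul_mem hU hV
  rw [re_trace_conjDiag_mul_conjDiag]
  set C := Uᴴ * V
  have hrow : ∀ f : a → ℝ, ∑ i, f i = ∑ i, ∑ j, ‖C i j‖ ^ 2 * f i := fun f => by
    simp only [← Finset.sum_mul, sum_row_sq_norm hC, one_mul]
  have hcol : ∑ j, q j = ∑ i, ∑ j, ‖C i j‖ ^ 2 * q j := by
    rw [Finset.sum_comm]
    simp only [← Finset.sum_mul, sum_col_sq_norm hC, one_mul]
  rw [hrow p, hcol, hrow fun i => p i * Real.log (p i),
    ← Finset.sum_add_distrib, ← Finset.sum_sub_distrib]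
  refine Finset.sum_le_sum fun i _ => ?_
  rw [← Finset.sum_add_distrib, ← Finset.sum_sub_distrib]
  refine Finset.sum_le_sum fun j _ => ?_
  have := mul_le_mul_of_nonneg_left (mul_log_add_sub_le (hp i) (hq j)) (sq_nonneg ‖C i j‖)
  linarith

/-- If `0 ≤ A ≤ B` and `B > 0`, then `p ⟨u, B⁻¹ u⟩ ≤ 1` for every eigenvalue `p` of `A` with unit
eigenvector `u`. The sum on the left is `⟨u, B⁻¹ u⟩` in an eigenbasis of `B`. -/
theorem eigenvalue_mul_sum_div_le_one {U W : Matrix a a ℂ} (hU : U ∈ unitaryGroup a ℂ)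
    (hW : W ∈ unitaryGroup a ℂ) {p b : a → ℝ} (hp : ∀ i, 0 ≤ p i) (hb : ∀ i, 0 < b i)
    (hle : (conjDiag W b - conjDiag U p).PosSemidef) (i : a) :
    p i * ∑ j, ‖(Uᴴ * W) i j‖ ^ 2 / b j ≤ 1 := by
  have hC := conjTranspose_mul_mem hU hW
  have h1 : Wᴴ * (conjDiag W b - conjDiag U p) * W =
      diagonal (fun j => (b j : ℂ)) - (Uᴴ * W)ᴴ * diagonal (fun j => (p j : ℂ)) * (Uᴴ * W) := by
    have : Wᴴ * (conjDiag W b - conjDiag U p) * W =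
        (Wᴴ * W) * diagonal (fun j => (b j : ℂ)) * (Wᴴ * W) -
        (Uᴴ * W)ᴴ * diagonal (fun j => (p j : ℂ)) * (Uᴴ * W) := by
      simp only [conjDiag, Matrix.mul_assoc, mul_sub, sub_mul, conjTranspose_mul,
        conjTranspose_conjTranspose]
    rw [this, conjTranspose_mul_self_of_mem hW, mul_one, one_mul]
  have h2 := hle.conjTranspose_mul_mul_same W
  rw [h1] at h2
  set C := Uᴴ * W
  set t : ℝ := ∑ j, ‖C i j‖ ^ 2 / b j with ht
  -- the test vector is `B⁻¹ u`, written in the eigenbasis of `B`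
  let y : a → ℂ := fun j => star (C i j) / (b j : ℂ)
  have h3 := h2.dotProduct_mulVec_nonneg y
  have hCy : (C *ᵥ y) i = (t : ℂ) := by
    simp only [mulVec, dotProduct, y, ht, Complex.ofReal_sum]
    refine Finset.sum_congr rfl fun j _ => ?_
    rw [mul_div_assoc', Complex.star_def, Complex.mul_conj, Complex.normSq_eq_norm_sq]
    push_cast; rfl
  have hB : star y ⬝ᵥ (diagonal (fun j => (b j : ℂ)) *ᵥ y) = (t : ℂ) := by
    simp only [dotProduct, mulVec_diagonal, y, ht, Complex.ofReal_sum, Pi.star_apply]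
    refine Finset.sum_congr rfl fun j _ => ?_
    have hbj : (b j : ℂ) ≠ 0 := by exact_mod_cast (hb j).ne'
    simp only [Complex.star_def, map_div₀, Complex.conj_conj, Complex.conj_ofReal]
    rw [mul_div_cancel₀ _ hbj, div_mul_eq_mul_div, Complex.mul_conj, Complex.normSq_eq_norm_sq]
    push_cast; rfl
  have hA : star y ⬝ᵥ ((Cᴴ * diagonal (fun j => (p j : ℂ)) * C) *ᵥ y) =
      ((∑ k, p k * ‖(C *ᵥ y) k‖ ^ 2 : ℝ) : ℂ) := by
    rw [← mulVec_mulVec, ← mulVec_mulVec, dotProduct_mulVec, ← star_mulVec]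
    simp only [dotProduct, mulVec_diagonal, Complex.ofReal_sum, Pi.star_apply]
    refine Finset.sum_congr rfl fun k _ => ?_
    rw [mul_left_comm, mul_comm (star _), Complex.star_def, Complex.mul_conj,
      Complex.normSq_eq_norm_sq]
    push_cast; rfl
  rw [sub_mulVec, dotProduct_sub, hA, hB, ← Complex.ofReal_sub, Complex.zero_le_real] at h3
  have h4 : p i * t ^ 2 ≤ ∑ k, p k * ‖(C *ᵥ y) k‖ ^ 2 := by
    have := Finset.single_le_sum (f := fun k => p k * ‖(C *ᵥ y) k‖ ^ 2)
      (fun k _ => mul_nonneg (hp k) (sq_nonneg _)) (Finset.mem_univ i)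
    simpa only [hCy, Complex.norm_real, Real.norm_eq_abs, sq_abs] using this
  have ht0 : 0 ≤ t := Finset.sum_nonneg fun j _ => div_nonneg (sq_nonneg _) (hb j).le
  rcases ht0.eq_or_lt with h0 | h0
  · rw [← h0]; simp
  · have : (p i * t) * t ≤ 1 * t := by nlinarith
    exact le_of_mul_le_mul_right this h0

/-- If `0 ≤ A ≤ B` and `B > 0`, then `Tr A log A ≤ Tr A log B`; this is the consequence of the operator
monotonicity of the logarithm that the entropy estimate needs. -/
theorem sum_mul_log_le_of_le {U W : Matrix a a ℂ} (hU : U ∈ unitaryGroup a ℂ)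
    (hW : W ∈ unitaryGroup a ℂ) {p b : a → ℝ} (hp : ∀ i, 0 ≤ p i) (hb : ∀ i, 0 < b i)
    (hle : (conjDiag W b - conjDiag U p).PosSemidef) :
    ∑ i, p i * Real.log (p i) ≤
      (conjDiag U p * conjDiag W (fun i => Real.log (b i))).trace.re := by
  have hC := conjTranspose_mul_mem hU hW
  have hkey := eigenvalue_mul_sum_div_le_one hU hW hp hb hle
  rw [re_trace_conjDiag_mul_conjDiag]
  set C := Uᴴ * W
  refine Finset.sum_le_sum fun i _ => ?_
  rcases (hp i).eq_or_lt with h0 | h0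
  · simp [← h0]
  -- concavity of the logarithm, in the tangent form `log (p / b) ≤ p / b - 1`
  have h1 : ∀ j, ‖C i j‖ ^ 2 * (Real.log (p i) + 1) - p i * (‖C i j‖ ^ 2 / b j) ≤
      ‖C i j‖ ^ 2 * Real.log (b j) := fun j => by
    have h := Real.log_le_sub_one_of_pos (div_pos h0 (hb j))
    rw [Real.log_div h0.ne' (hb j).ne'] at h
    have h2 := mul_le_mul_of_nonneg_left h (sq_nonneg ‖C i j‖)
    have h3 : ‖C i j‖ ^ 2 * (p i / b j - 1) = p i * (‖C i j‖ ^ 2 / b j) - ‖C i j‖ ^ 2 := by ring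
    linarith
  have h2 := Finset.sum_le_sum fun j (_ : j ∈ Finset.univ) => h1 j
  rw [Finset.sum_sub_distrib, ← Finset.sum_mul, ← Finset.mul_sum, sum_row_sq_norm hC] at h2
  have h3 : Real.log (p i) ≤ ∑ j, ‖C i j‖ ^ 2 * Real.log (b j) := by linarith [hkey i]
  calc p i * Real.log (p i) ≤ p i * ∑ j, ‖C i j‖ ^ 2 * Real.log (b j) :=
        mul_le_mul_of_nonneg_left h3 h0.le
    _ = _ := by
        rw [Finset.mul_sum]
        exact Finset.sum_congr rfl fun j _ => by ring

end Entropy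

/-! ### Rank-one projections -/

section Ket

variable {a : Type*}

theorem isHermitian_ketBra (Ψ : EuclideanSpace ℂ a) : (ketBra Ψ).IsHermitian := by
  ext i j
  simp [ketBra, mul_comm]

variable [Fintype a]

theorem trace_ketBra {Ψ : EuclideanSpace ℂ a} (hΨ : ‖Ψ‖ = 1) : (ketBra Ψ).trace = 1 := by
  have h := EuclideanSpace.norm_sq_eq Ψ
  rw [hΨ, one_pow] at h
  simp only [trace, diag_apply, ketBra, of_apply, Complex.star_def, Complex.mul_conj,
    Complex.normSq_eq_norm_sq]
  exact_mod_cast h.symm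

theorem ketBra_mul_self {Ψ : EuclideanSpace ℂ a} (hΨ : ‖Ψ‖ = 1) :
    ketBra Ψ * ketBra Ψ = ketBra Ψ := by
  have h := trace_ketBra hΨ
  simp only [trace, diag_apply, ketBra, of_apply] at h
  ext i j
  simp only [mul_apply, ketBra, of_apply]
  calc ∑ k, Ψ i * star (Ψ k) * (Ψ k * star (Ψ j))
      = Ψ i * star (Ψ j) * ∑ k, Ψ k * star (Ψ k) := by
        rw [Finset.mul_sum]
        exact Finset.sum_congr rfl fun k _ => by ring
    _ = _ := by rw [h, mul_one]

end Ket

/-! ### Partial traces and the reduction criterion -/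

section PartialTrace

variable {a b : Type*} [Fintype a] [DecidableEq a] [Fintype b] [DecidableEq b]

omit [DecidableEq a] in
theorem trace_mul_kronecker_one (X : Matrix (a × b) (a × b) ℂ) (A : Matrix a a ℂ) :
    (X * (A ⊗ₖ (1 : Matrix b b ℂ))).trace = (reducedFst X * A).trace := by
  simp only [trace, diag_apply, mul_apply, kronecker_apply, reducedFst, of_apply,
    Fintype.sum_prod_type, one_apply, mul_ite, mul_one, mul_zero, Finset.sum_ite_eq',
    Finset.mem_univ, if_true, Finset.sum_mul]
  refine Finset.sum_congr rfl fun i _ => ?_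
  rw [Finset.sum_comm]

omit [DecidableEq b] in
theorem trace_mul_one_kronecker (X : Matrix (a × b) (a × b) ℂ) (B : Matrix b b ℂ) :
    (X * ((1 : Matrix a a ℂ) ⊗ₖ B)).trace = (reducedSnd X * B).trace := by
  have h : ∀ i k, (X * ((1 : Matrix a a ℂ) ⊗ₖ B)) (i, k) (i, k) =
      ∑ l, X (i, k) (i, l) * B l k := fun i k => by
    rw [mul_apply, Fintype.sum_prod_type_right]
    simp [one_apply]
  simp only [trace, diag_apply, Fintype.sum_prod_type, h]
  rw [Finset.sum_comm]
  refine Finset.sum_congr rfl fun k _ => ?_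
  rw [Finset.sum_comm]
  simp only [mul_apply, reducedSnd, of_apply, Finset.sum_mul]

omit [Fintype a] [DecidableEq a] [DecidableEq b] in
theorem reducedFst_sum_smul_kronecker {n : ℕ} (w : Fin n → ℝ) (A : Fin n → Matrix a a ℂ)
    {B : Fin n → Matrix b b ℂ} (hB : ∀ k, (B k).trace = 1) :
    reducedFst (∑ k, (w k : ℂ) • (A k ⊗ₖ B k)) = ∑ k, (w k : ℂ) • A k := by
  ext i j
  simp only [reducedFst, of_apply, Matrix.sum_apply, Matrix.smul_apply, kronecker_apply,
    smul_eq_mul]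
  rw [Finset.sum_comm]
  refine Finset.sum_congr rfl fun k _ => ?_
  rw [← Finset.mul_sum, ← Finset.mul_sum]
  have : ∑ l, B k l l = 1 := hB k
  rw [this, mul_one]

theorem reducedSnd_trace (X : Matrix (a × b) (a × b) ℂ) : (reducedSnd X).trace = X.trace := by
  have := trace_mul_one_kronecker X (1 : Matrix b b ℂ)
  rwa [one_kronecker_one, mul_one, mul_one, eq_comm] at this

theorem reducedFst_trace (X : Matrix (a × b) (a × b) ℂ) : (reducedFst X).trace = X.trace := by
  have := trace_mul_kronecker_one X (1 : Matrix a a ℂ)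
  rwa [one_kronecker_one, mul_one, mul_one, eq_comm] at this

theorem IsDensity.posSemidef_one_sub {B : Matrix b b ℂ} (hB : IsDensity B) :
    (1 - B).PosSemidef := by
  obtain ⟨V, hV, h⟩ := exists_eq_conjDiag hB.1.1
  have h0 := hB.1.eigenvalues_nonneg
  set f := hB.1.1.eigenvalues
  have hsum : ∑ i, f i = 1 := sum_eq_one_of_trace hV h hB.2
  have h1 : 1 - B = conjDiag V (fun i => 1 + (-1) * f i) := by
    rw [conjDiag_add, conjDiag_smul, conjDiag_const hV, ← h]
    simp [sub_eq_add_neg]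
  rw [h1]
  refine posSemidef_conjDiag V fun i => ?_
  have := Finset.single_le_sum (fun k _ => h0 k) (Finset.mem_univ i)
  linarith

omit [DecidableEq a] [DecidableEq b] in
theorem IsSeparable.isDensity {ρ : Matrix (a × b) (a × b) ℂ} (h : IsSeparable ρ) :
    IsDensity ρ := by
  obtain ⟨n, w, A, B, hw, hw1, hA, hB, rfl⟩ := h
  refine ⟨posSemidef_sum _ fun k _ => ?_, ?_⟩
  · exact ((hA k).1.kronecker (hB k).1).smul (by exact_mod_cast (hw k).le)
  · simp only [trace_sum, trace_smul, trace_kronecker, (hA _).2, (hB _).2, mul_one, smul_eq_mul]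
    exact_mod_cast hw1

theorem IsSeparable.reducedFst_isDensity {ρ : Matrix (a × b) (a × b) ℂ} (h : IsSeparable ρ) :
    IsDensity (reducedFst ρ) := by
  refine ⟨?_, (reducedFst_trace ρ).trans h.isDensity.2⟩
  obtain ⟨n, w, A, B, hw, hw1, hA, hB, rfl⟩ := h
  rw [reducedFst_sum_smul_kronecker w A fun k => (hB k).2]
  exact posSemidef_sum _ fun k _ => (hA k).1.smul (by exact_mod_cast (hw k).le)

omit [DecidableEq a] in
/-- The reduction criterion: a separable state satisfies `ρ ≤ ρ_M ⊗ 1`. Maximally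
entangled states on two equal factors of dimension at least two violate it. -/
theorem IsSeparable.posSemidef_reducedFst_kronecker_one_sub {ρ : Matrix (a × b) (a × b) ℂ}
    (h : IsSeparable ρ) : (reducedFst ρ ⊗ₖ (1 : Matrix b b ℂ) - ρ).PosSemidef := by
  obtain ⟨n, w, A, B, hw, hw1, hA, hB, rfl⟩ := h
  have : reducedFst (∑ k, (w k : ℂ) • (A k ⊗ₖ B k)) ⊗ₖ (1 : Matrix b b ℂ) -
      ∑ k, (w k : ℂ) • (A k ⊗ₖ B k) = ∑ k, (w k : ℂ) • (A k ⊗ₖ (1 - B k)) := by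
    rw [reducedFst_sum_smul_kronecker w A fun k => (hB k).2]
    ext ⟨i, k⟩ ⟨j, l⟩
    simp only [Matrix.sub_apply, kronecker_apply, Matrix.sum_apply, Matrix.smul_apply,
      smul_eq_mul, Finset.sum_mul, ← Finset.sum_sub_distrib]
    exact Finset.sum_congr rfl fun k _ => by ring
  rw [this]
  exact posSemidef_sum _ fun k _ =>
    ((hA k).1.kronecker (hB k).posSemidef_one_sub).smul (by exact_mod_cast (hw k).le)

end PartialTrace

/-! ### Gibbs states -/

section Gibbs

variable {r : Type*} [Fintype r] [DecidableEq r]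

theorem gibbs_conjDiag {V : Matrix r r ℂ} (hV : V ∈ unitaryGroup r ℂ) (β : ℝ) (h : r → ℝ) :
    gibbs β (conjDiag V h) =
      conjDiag V (fun i => Real.exp (-β * h i) / ∑ k, Real.exp (-β * h k)) := by
  have hinv : V⁻¹ = Vᴴ := inv_eq_left_inv (conjTranspose_mul_self_of_mem hV)
  have hu : IsUnit V := IsUnit.of_mul_eq_one _ (mul_conjTranspose_self_of_mem hV)
  have hexp : NormedSpace.exp (-(β : ℂ) • conjDiag V h) =
      conjDiag V (fun i => Real.exp (-β * h i)) := by
    rw [← Complex.ofReal_neg, ← conjDiag_smul, conjDiag, ← hinv, exp_conj V _ hu, exp_diagonal,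
      hinv, conjDiag]
    congr 3
    ext i
    simp [Pi.coe_exp, ← Complex.exp_eq_exp_ℂ]
  rw [gibbs, hexp, trace_conjDiag hV, ← Complex.ofReal_inv, ← conjDiag_smul]
  congr 1
  ext i
  rw [div_eq_inv_mul]

end Gibbs

/-! ### Heat dissipation -/

section Heat

variable {m s : Type*} [Fintype m] [Fintype s] [DecidableEq m] [DecidableEq s]

/-- The Landauer bound with an arbitrary comparison operator `σ > 0` on memory and system, `σ` being
given by its eigenvectors `W` and eigenvalues `q`, and `ρ_MS` by `V` and `p`:
`Tr ρ'_MS log σ + 1 - Tr σ + S(ρ_MS) ≤ β (-Q)`. It is linear in the final state. -/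
theorem ThermalProcess.le_mul_neg_heat (P : ThermalProcess m s) (β : ℝ)
    {V W : Matrix (m × s) (m × s) ℂ} (hV : V ∈ unitaryGroup (m × s) ℂ)
    (hW : W ∈ unitaryGroup (m × s) ℂ) {p q : m × s → ℝ} (hp : ∀ i, 0 ≤ p i)
    (hp1 : ∑ i, p i = 1) (hq : ∀ i, 0 < q i) :
    (P.finalMS β (conjDiag V p) * conjDiag W (fun i => Real.log (q i))).trace.re + 1 - ∑ i, q i -
      ∑ i, p i * Real.log (p i) ≤ β * -P.heat β (conjDiag V p) := by
  obtain ⟨X, hX, hH⟩ := exists_eq_conjDiag P.isHermitian_HR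
  set h := P.isHermitian_HR.eigenvalues
  set Z := ∑ k, Real.exp (-β * h k) with hZ
  set g := fun i => Real.exp (-β * h i) / Z with hg
  have hgibbs : gibbs β P.HR = conjDiag X g := by
    conv_lhs => rw [hH]
    exact gibbs_conjDiag hX β h
  have : Nonempty (Fin P.dim) := ⟨⟨0, P.dim_pos⟩⟩
  have hZ0 : 0 < Z := Finset.sum_pos (fun k _ => Real.exp_pos _) Finset.univ_nonempty
  have hg0 : ∀ i, 0 < g i := fun i => div_pos (Real.exp_pos _) hZ0
  have hg1 : ∑ i, g i = 1 := by rw [hg, ← Finset.sum_div, ← hZ, div_self hZ0.ne']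
  have hlog : ∀ i, Real.log (g i) = -β * h i + -Real.log Z := fun i => by
    rw [Real.log_div (Real.exp_pos _).ne' hZ0.ne', Real.log_exp, sub_eq_add_neg]
  have hfin : P.finalState β (conjDiag V p) =
      conjDiag (P.U * (V ⊗ₖ X)) (fun x => p x.1 * g x.2) := by
    rw [ThermalProcess.finalState, hgibbs, conjDiag_kronecker, conjDiag_conj]
  have hsum : ∀ f : m × s → ℝ, ∑ x : (m × s) × Fin P.dim, f x.1 * g x.2 = ∑ i, f i := fun f => by
    rw [Fintype.sum_prod_type]
    simp only [← Finset.mul_sum, hg1, mul_one]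
  have hU : P.U * (V ⊗ₖ X) ∈ unitaryGroup ((m × s) × Fin P.dim) ℂ :=
    mul_mem P.unitary_U (kronecker_mem_unitary hV hX)
  have hkl := klein_inequality hU (kronecker_mem_unitary hW hX)
    (p := fun x => p x.1 * g x.2) (q := fun x => q x.1 * g x.2)
    (fun x => mul_nonneg (hp _) (hg0 _).le) (fun x => mul_pos (hq _) (hg0 _))
  rw [← hfin, hsum, hsum, hp1] at hkl
  have hLg : conjDiag X (fun i => Real.log (g i)) =
      (-β : ℂ) • P.HR + (-Real.log Z : ℂ) • (1 : Matrix (Fin P.dim) (Fin P.dim) ℂ) := by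
    simp only [hlog]
    rw [conjDiag_add, conjDiag_smul, conjDiag_const hX, ← hH]
    push_cast; rfl
  have htr : (P.finalR β (conjDiag V p)).trace = 1 := by
    rw [ThermalProcess.finalR, reducedSnd_trace, hfin, trace_conjDiag hU, hsum, hp1,
      Complex.ofReal_one]
  have hent : ∑ x : (m × s) × Fin P.dim, p x.1 * g x.2 * Real.log (p x.1 * g x.2) =
      ∑ i, p i * Real.log (p i) + ∑ k, g k * Real.log (g k) := by
    have : ∀ x : (m × s) × Fin P.dim, p x.1 * g x.2 * Real.log (p x.1 * g x.2) =
        (p x.1 * Real.log (p x.1)) * g x.2 + p x.1 * (g x.2 * Real.log (g x.2)) := fun x => by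
      rcases (hp x.1).eq_or_lt with h0 | h0
      · simp [← h0]
      · rw [Real.log_mul h0.ne' (hg0 _).ne']; ring
    simp only [this]
    rw [Finset.sum_add_distrib, hsum (fun i => p i * Real.log (p i))]
    congr 1
    rw [Fintype.sum_prod_type]
    dsimp only
    rw [← Finset.sum_mul_sum, hp1, one_mul]
  have hgsum : ∑ k, g k * Real.log (g k) = -β * ∑ k, h k * g k + -Real.log Z := by
    simp only [hlog, mul_add, Finset.sum_add_distrib]
    rw [← Finset.sum_mul, hg1, one_mul, Finset.mul_sum]
    congr 1
    exact Finset.sum_congr rfl fun k _ => by ring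
  have hHg : (P.HR * gibbs β P.HR).trace.re = ∑ k, h k * g k := by
    rw [hgibbs]
    conv_lhs => rw [hH]
    rw [conjDiag_mul hX, trace_conjDiag hX, Complex.ofReal_re]
  rw [conjDiag_log_kronecker hW hX hq hg0, mul_add, trace_add, trace_mul_kronecker_one,
    trace_mul_one_kronecker, hLg, mul_add, Matrix.mul_smul, Matrix.mul_smul, mul_one, trace_add, trace_smul, trace_smul,
    hent,
    hgsum] at hkl
  change ((P.finalMS β (conjDiag V p) * _).trace + (_ • (P.finalR β (conjDiag V p) * _).trace +
    _ • (P.finalR β (conjDiag V p)).trace)).re + _ - _ ≤ _ at hkl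
  rw [htr, trace_mul_comm (P.finalR β (conjDiag V p))] at hkl
  rw [ThermalProcess.heat, neg_neg, mul_sub, trace_sub, Complex.sub_re, hHg]
  simp only [Complex.add_re, smul_eq_mul, mul_one, ← Complex.ofReal_neg, Complex.re_ofReal_mul,
    Complex.ofReal_re] at hkl
  linarith

/-- The comparison operator `σ = (ρ_M + δ) ⊗ (|Ψ⟩⟨Ψ| + δ)` with small `δ > 0` makes the Landauer bound
nonnegative up to `ε` at the purified state; `L` is `log σ`. -/
theorem IsSeparable.exists_neg_heat_bound {ρ : Matrix (m × s) (m × s) ℂ} (hρ : IsSeparable ρ)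
    (β : ℝ) {Ψ : EuclideanSpace ℂ s} (hΨ : ‖Ψ‖ = 1) {ε : ℝ} (hε : 0 < ε) :
    ∃ L : Matrix (m × s) (m × s) ℂ, ∀ P : ThermalProcess m s,
      (P.finalMS β ρ * L).trace.re - ((reducedFst ρ ⊗ₖ ketBra Ψ) * L).trace.re - ε ≤
        β * -P.heat β ρ := by
  obtain ⟨V, hV, hVρ⟩ := exists_eq_conjDiag hρ.isDensity.1.1
  have hp := hρ.isDensity.1.eigenvalues_nonneg
  set p := hρ.isDensity.1.1.eigenvalues
  have hp1 : ∑ i, p i = 1 := sum_eq_one_of_trace hV hVρ hρ.isDensity.2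
  obtain ⟨A, hA, hAρ⟩ := exists_eq_conjDiag hρ.reducedFst_isDensity.1.1
  have hr := hρ.reducedFst_isDensity.1.eigenvalues_nonneg
  set r := hρ.reducedFst_isDensity.1.1.eigenvalues
  have hr1 : ∑ i, r i = 1 := sum_eq_one_of_trace hA hAρ hρ.reducedFst_isDensity.2
  obtain ⟨Y, hY, hYK⟩ := exists_eq_conjDiag (isHermitian_ketBra Ψ)
  set μ := (isHermitian_ketBra Ψ).eigenvalues
  have hμ1 : ∑ i, μ i = 1 := sum_eq_one_of_trace hY hYK (trace_ketBra hΨ)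
  have hμ : ∀ i, μ i = 0 ∨ μ i = 1 := fun i => by
    have h := ketBra_mul_self hΨ
    rw [hYK, conjDiag_mul hY] at h
    have h2 : μ i * μ i = μ i := congrFun (conjDiag_injective hY h) i
    rcases eq_or_ne (μ i) 0 with h0 | h0
    · exact Or.inl h0
    · exact Or.inr (mul_right_cancel₀ h0 (h2.trans (one_mul _).symm))
  obtain ⟨δ, hδ, hδε⟩ : ∃ δ : ℝ, 0 < δ ∧
      (1 + δ * Fintype.card m) * (1 + δ * Fintype.card s) < 1 + ε := by
    have hc : Continuous fun δ : ℝ => (1 + δ * Fintype.card m) * (1 + δ * Fintype.card s) := by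
      fun_prop
    have hev := (hc.tendsto 0).eventually_lt_const (show _ < 1 + ε by simpa using hε)
    obtain ⟨δ, h1, h2⟩ := ((hev.filter_mono nhdsWithin_le_nhds).and
      (self_mem_nhdsWithin (s := Set.Ioi (0 : ℝ)))).exists
    exact ⟨δ, h2, h1⟩
  have hrδ : ∀ i, 0 < r i + δ := fun i => by have := hr i; linarith
  have hμδ : ∀ i, 0 < μ i + δ := fun i => by rcases hμ i with h | h <;> rw [h] <;> linarith
  refine ⟨conjDiag (A ⊗ₖ Y) (fun x => Real.log ((r x.1 + δ) * (μ x.2 + δ))), fun P => ?_⟩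
  have hheat := P.le_mul_neg_heat β hV (kronecker_mem_unitary hA hY) hp hp1
    (q := fun x => (r x.1 + δ) * (μ x.2 + δ)) (fun x => mul_pos (hrδ _) (hμδ _))
  rw [← hVρ] at hheat
  have hq : ∑ x : m × s, (r x.1 + δ) * (μ x.2 + δ) =
      (1 + δ * Fintype.card m) * (1 + δ * Fintype.card s) := by
    rw [Fintype.sum_prod_type]
    dsimp only
    rw [← Finset.sum_mul_sum, Finset.sum_add_distrib,
      Finset.sum_add_distrib, hr1, hμ1]
    simp [mul_comm]
  have hM : ∑ i, p i * Real.log (p i) ≤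
      (reducedFst ρ * conjDiag A (fun i => Real.log (r i + δ))).trace.re := by
    have e : ∀ f : m → ℝ, conjDiag A f ⊗ₖ (1 : Matrix s s ℂ) =
        conjDiag (A ⊗ₖ (1 : Matrix s s ℂ)) (fun x => f x.1) := fun f => by
      have e1 := conjDiag_const (one_mem (unitaryGroup s ℂ)) 1
      rw [Complex.ofReal_one, one_smul] at e1
      conv_lhs => rw [← e1, conjDiag_kronecker]
      simp only [mul_one]
    rw [← trace_mul_kronecker_one, e]
    conv_rhs => rw [hVρ]
    refine sum_mul_log_le_of_le hV (kronecker_mem_unitary hA (one_mem _)) hp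
      (b := fun x => r x.1 + δ) (fun x => hrδ x.1) ?_
    rw [← e (fun i => r i + δ), conjDiag_add, conjDiag_const hA, ← hAρ, ← hVρ, add_kronecker,
      smul_kronecker, one_kronecker_one, add_sub_right_comm]
    exact hρ.posSemidef_reducedFst_kronecker_one_sub.add
      (PosSemidef.one.smul (by exact_mod_cast hδ.le))
  have hS : 0 ≤ (ketBra Ψ * conjDiag Y (fun i => Real.log (μ i + δ))).trace.re := by
    conv_rhs => rw [hYK]
    rw [conjDiag_mul hY, trace_conjDiag hY, Complex.ofReal_re]
    refine Finset.sum_nonneg fun i _ => ?_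
    rcases hμ i with h | h
    · simp [h]
    · rw [h, one_mul]
      exact Real.log_nonneg (by linarith)
  have hτ : ((reducedFst ρ ⊗ₖ ketBra Ψ) *
      conjDiag (A ⊗ₖ Y) (fun x => Real.log ((r x.1 + δ) * (μ x.2 + δ)))).trace.re =
      (reducedFst ρ * conjDiag A (fun i => Real.log (r i + δ))).trace.re +
        (ketBra Ψ * conjDiag Y (fun i => Real.log (μ i + δ))).trace.re := by
    rw [conjDiag_log_kronecker hA hY hrδ hμδ, mul_add, trace_add, ← mul_kronecker_mul,
      ← mul_kronecker_mul, trace_kronecker, trace_kronecker, mul_one, mul_one, trace_ketBra hΨ,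
      hρ.reducedFst_isDensity.2, mul_one, one_mul, Complex.add_re]
  rw [hq] at hheat
  rw [hτ]
  linarith

end Heat

open Filter in
theorem IsSeparable.eventually_neg_le_neg_heat {m s : Type*} [Fintype m] [Fintype s]
    [DecidableEq m] [DecidableEq s] {ρ : Matrix (m × s) (m × s) ℂ} (hρ : IsSeparable ρ) {β : ℝ}
    (hβ : 0 < β) {P : ℕ → ThermalProcess m s}
    (hP : IsLimitMemoryAssistedPurification ρ (fun n => (P n).finalMS β ρ)) {ε : ℝ} (hε : 0 < ε) :
    ∀ᶠ n in atTop, -ε ≤ -(P n).heat β ρ := by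
  obtain ⟨Ψ, hΨ, hlim⟩ := hP
  have hε2 : 0 < β * ε / 2 := by positivity
  obtain ⟨L, hL⟩ := hρ.exists_neg_heat_bound β hΨ hε2
  have hc : Continuous fun X : Matrix (m × s) (m × s) ℂ => (X * L).trace.re :=
    Complex.continuous_re.comp (continuous_id.matrix_mul continuous_const).matrix_trace
  have hev := ((hc.tendsto _).comp hlim).eventually_const_lt
    (sub_lt_self (((reducedFst ρ ⊗ₖ ketBra Ψ) * L).trace.re) hε2)
  filter_upwards [hev] with n hn
  have h := hL (P n)
  simp only [Function.comp_apply] at hn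
  have : β * -ε ≤ β * -(P n).heat β ρ := by linarith
  exact le_of_mul_le_mul_left this hβ

end MemoryPurification

theorem theorem1 {m s : Type*} [Fintype m] [Fintype s] [DecidableEq m] [DecidableEq s]
    (ρ : Matrix (m × s) (m × s) ℂ) (hρ : MemoryPurification.IsSeparable ρ)
    (β : ℝ) (hβ : 0 < β) :
    (∀ P : MemoryPurification.ThermalProcess m s,
      MemoryPurification.IsMemoryAssistedPurification ρ (P.finalMS β ρ) →
        0 ≤ -P.heat β ρ) ∧
    (∀ P : ℕ → MemoryPurification.ThermalProcess m s,
      MemoryPurification.IsLimitMemoryAssistedPurification ρ (fun n => (P n).finalMS β ρ) →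
        ∀ ε : ℝ, 0 < ε → ∀ᶠ n in Filter.atTop, -ε ≤ -(P n).heat β ρ) := by
  refine ⟨fun P ⟨Ψ, hΨ, hfin⟩ => ?_, fun P hP ε hε => hρ.eventually_neg_le_neg_heat hβ hP hε⟩
  -- an exact purification is the limit of the constant sequence of processes
  refine le_of_forall_pos_le_add fun ε hε => ?_
  obtain ⟨n, hn⟩ := (hρ.eventually_neg_le_neg_heat hβ (P := fun _ => P)
    ⟨Ψ, hΨ, by simp only [hfin]; exact tendsto_const_nhds⟩ hε).exists
  linarith
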